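/- Let $p>3$ be a prime, let $K$ be a quadratic field (an extension of $\mathbb Q$ of degree $2$), and let $L$ be a $\mathbb Z_p$-extension of $K$, that is, a Galois extension $L/K$ whose Galois group $\operatorname{Gal}(L/K)$ is isomorphic, as a topological group, to the additive group $\mathbb Z_p$ of $p$-adic integers. Regard $K\subseteq L$ as subfields of an algebraically closed field $\Omega$ of characteristic $0$ (for instance an algebraic closure of $L$), and for a positive integer $n$ let $\mu_n=\{\zeta\in\Omega:\zeta^n=1\}$ be the group of all $n$-th roots of unity. If $n$ is a positive integer with $\mu_n\subset L$, then $\mu_n\subset K$. -/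

import Mathlib

/-- `L / K` is a `ℤ_p`-extension: it is Galois (possibly of infinite degree) and its Galois group,
with the Krull topology, is isomorphic as a topological group to the additive group of the
`p`-adic integers. -/
structure IsZpExtension (p : ℕ) [Fact p.Prime] (K L : Type*) [Field K] [Field L]
    [Algebra K L] : Prop where
  isGalois : IsGalois K L
  nonempty_continuousMulEquiv : Nonempty (Gal(L/K) ≃ₜ* Multiplicative ℤ_[p])

/-- The set `μ_n` of all `n`-th roots of unity of the field `Ω`. -/
def muSet (n : ℕ) (Ω : Type*) [Field Ω] : Set Ω := {ζ : Ω | ζ ^ n = 1}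

/-! Splitting along coprime factors reduces the claim to ζ of prime power order r^k. If ζ ∉ K, then
[K(ζ):K] = p^m with m > 0, so φ(r^k) divides 2p^m and is at least p^m; for p > 3 this forces k = 1
and r = 2p^m + 1.

Put ζ in a cyclic layer M/K of degree p^a with a > m, and let Q be a prime of M above r. Since r is
totally ramified in ℚ(ζ), K is only quadratic, and the subgroups of Gal(M/K) form a chain, the
inertia group at Q is all of Gal(M/K) and the residue field has r elements. As r ≠ p, this
ramification is tame, so p^a divides r - 1 = 2p^m, which is absurd. -/

/-! ### Tame inertia in Dedekind domains -/

section Tame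

variable {B G : Type*} [CommRing B] [Group G] [MulSemiringAction G B] {P : Ideal B} {σ : G}

theorem Ideal.smul_mem_of_mem_inertia (hσ : σ ∈ P.toAddSubgroup.inertia G) {x : B} (hx : x ∈ P) :
    σ • x ∈ P := by
  simpa using P.add_mem (hσ x) hx

theorem Ideal.smul_mem_pow_of_mem_inertia (hσ : σ ∈ P.toAddSubgroup.inertia G) (i : ℕ) {x : B}
    (hx : x ∈ P ^ i) : σ • x ∈ P ^ i := by
  have h : (P ^ i).map (MulSemiringAction.toRingHom G B σ) ≤ P ^ i := by
    rw [Ideal.map_pow]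
    refine Ideal.pow_right_mono (Ideal.map_le_iff_le_comap.2 fun x hx ↦ ?_) i
    exact Ideal.smul_mem_of_mem_inertia hσ hx
  exact h (Ideal.mem_map_of_mem _ hx)

/-- An element of the inertia group that acts trivially on `P / P ^ 2` acts trivially on all
the quotients `P ^ i / P ^ (i + 1)`. -/
theorem Ideal.smul_sub_mem_pow_succ (hσ : σ ∈ P.toAddSubgroup.inertia G)
    (hσ' : ∀ x ∈ P, σ • x - x ∈ P ^ 2) (i : ℕ) {x : B} (hx : x ∈ P ^ i) :
    σ • x - x ∈ P ^ (i + 1) := by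
  induction i generalizing x with
  | zero => simpa using hσ x
  | succ i ih =>
    rw [pow_succ] at hx
    induction hx using Submodule.mul_induction_on' with
    | mem_mul_mem a ha b hb =>
      have e : σ • (a * b) - a * b = σ • a * (σ • b - b) + (σ • a - a) * b := by
        rw [smul_mul']; ring
      rw [e]
      refine add_mem ?_ ?_
      · have := Ideal.mul_mem_mul (Ideal.smul_mem_pow_of_mem_inertia hσ i ha) (hσ' b hb)
        rwa [← pow_add] at this
      · have := Ideal.mul_mem_mul (ih ha) hb
        rwa [← pow_succ] at this
    | add a _ b _ ha hb =>
      rw [smul_add, add_sub_add_comm]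
      exact add_mem ha hb

/-- An element of the inertia group of order prime to the residue characteristic that acts
trivially on `P / P ^ 2` acts trivially. -/
theorem Ideal.smul_eq_of_pow_eq_one [IsDomain B] [IsNoetherianRing B] [P.IsMaximal]
    (hσ : σ ∈ P.toAddSubgroup.inertia G) (hσ' : ∀ x ∈ P, σ • x - x ∈ P ^ 2)
    {n : ℕ} (hn : (n : B) ∉ P) (h1 : σ ^ n = 1) (x : B) : σ • x = x := by
  set y := σ • x - x with hy
  -- The sum telescopes. If y ∈ P^i, all its terms agree with y modulo P^(i+1), so n * y ∈ P^(i+1);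
  -- as n is invertible modulo P, y lies in every P^i, and Krull's intersection theorem gives y = 0.
  have hsum : ∑ j ∈ Finset.range n, σ ^ j • y = 0 := by
    have : ∀ j, σ ^ j • y = σ ^ (j + 1) • x - σ ^ j • x := fun j ↦ by
      rw [hy, smul_sub, pow_succ, mul_smul]
    simp_rw [this]
    rw [Finset.sum_range_sub (fun j ↦ σ ^ j • x), h1]
    simp
  have hpow : ∀ i j, y ∈ P ^ i → σ ^ j • y - y ∈ P ^ (i + 1) := by
    intro i j hi
    induction j with
    | zero => simp
    | succ j ih =>
      have h2 := Ideal.smul_sub_mem_pow_succ hσ hσ' i hi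
      have h3 := Ideal.smul_mem_pow_of_mem_inertia hσ (i + 1) ih
      have e : σ ^ (j + 1) • y - y = σ • (σ ^ j • y - y) + (σ • y - y) := by
        rw [pow_succ', mul_smul, smul_sub σ (σ ^ j • y)]; ring
      rw [e]
      exact add_mem h3 h2
  have hmem : ∀ i, y ∈ P ^ i := by
    intro i
    induction i with
    | zero => simp
    | succ i ih =>
      have h2 : (n : B) * y ∈ P ^ (i + 1) := by
        have h3 : ∑ j ∈ Finset.range n, (σ ^ j • y - y) ∈ P ^ (i + 1) :=
          Submodule.sum_mem _ fun j _ ↦ hpow i j ih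
        rw [Finset.sum_sub_distrib, hsum, zero_sub] at h3
        simpa using h3
      obtain ⟨u, v, hv, huv⟩ := Ideal.IsMaximal.exists_inv (I := P) inferInstance hn
      have e : y = u * (n * y) + v * y := by linear_combination (-y) * huv
      rw [e]
      refine add_mem (Ideal.mul_mem_left _ _ h2) ?_
      rw [pow_succ']
      exact Ideal.mul_mem_mul hv ih
  have h0 : y ∈ ⨅ i, P ^ i := by simpa using hmem
  rw [Ideal.iInf_pow_eq_bot_of_isDomain P (Ideal.IsMaximal.ne_top inferInstance)] at h0
  exact sub_eq_zero.1 h0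

/-- On the line P / P^2, spanned by a uniformizer π, σ acts as multiplication by some u nonzero
modulo P, and u^(#(B ⧸ P) - 1) = 1 in the residue field. -/
theorem Ideal.smul_pow_card_sub_one_sub_mem [IsDedekindDomain B] [P.IsMaximal] (hP : P ≠ ⊥)
    [Finite (B ⧸ P)] (hσ : σ ∈ P.toAddSubgroup.inertia G) {x : B} (hx : x ∈ P) :
    σ ^ (Nat.card (B ⧸ P) - 1) • x - x ∈ P ^ 2 := by
  obtain ⟨π, hπ, hπ'⟩ := P.exists_mem_pow_notMem_pow_succ hP (Ideal.IsMaximal.ne_top inferInstance) 1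
  obtain ⟨u, e, he, hue⟩ := Ideal.exists_mul_add_mem_pow_succ hP π (σ • π) hπ hπ'
    (Ideal.smul_mem_pow_of_mem_inertia hσ 1 hπ)
  have hu : u ∉ P := by
    intro hu
    apply hπ'
    have h1 : σ • π ∈ P ^ (1 + 1) := by
      rw [← hue]
      refine add_mem ?_ he
      rw [pow_succ]
      exact Ideal.mul_mem_mul hπ hu
    simpa using Ideal.smul_mem_pow_of_mem_inertia (inv_mem hσ) _ h1
  have hpow : ∀ j, σ ^ j • π - u ^ j * π ∈ P ^ 2 := by
    intro j
    induction j with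
    | zero => simp
    | succ j ih =>
      have h2 := Ideal.smul_mem_pow_of_mem_inertia hσ 2 ih
      have h3 : (σ • u ^ j - u ^ j) * (σ • π) ∈ P ^ 2 := by
        rw [sq]
        rw [pow_one] at hπ
        exact Ideal.mul_mem_mul (hσ _) (Ideal.smul_mem_of_mem_inertia hσ hπ)
      have e : σ ^ (j + 1) • π - u ^ (j + 1) * π =
          σ • (σ ^ j • π - u ^ j * π) + (σ • u ^ j - u ^ j) * (σ • π) + u ^ j * e := by
        rw [pow_succ', mul_smul, smul_sub, smul_mul', ← hue]; ring
      rw [e]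
      exact add_mem (add_mem h2 h3) (Ideal.mul_mem_left _ _ he)
  set N := Nat.card (B ⧸ P) - 1
  have hN : u ^ N - 1 ∈ P := by
    let := Ideal.Quotient.field P
    have := Fintype.ofFinite (B ⧸ P)
    rw [← Ideal.Quotient.eq_zero_iff_mem, map_sub, map_pow, map_one, sub_eq_zero]
    have := FiniteField.pow_card_sub_one_eq_one (Ideal.Quotient.mk P u)
      (by rwa [ne_eq, Ideal.Quotient.eq_zero_iff_mem])
    rwa [← Nat.card_eq_fintype_card] at this
  obtain ⟨d, f, hf, hdf⟩ := Ideal.exists_mul_add_mem_pow_succ hP π x hπ hπ' (by simpa using hx)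
  have hτ : σ ^ N ∈ P.toAddSubgroup.inertia G := pow_mem hσ N
  rw [pow_one] at hπ
  have e : σ ^ N • x - x = d * (σ ^ N • π - u ^ N * π) + d * ((u ^ N - 1) * π)
      + (σ ^ N • d - d) * (σ ^ N • π) + (σ ^ N • f - f) := by
    rw [← hdf, smul_add, smul_mul']; ring
  rw [e]
  refine add_mem (add_mem (add_mem (Ideal.mul_mem_left _ _ (hpow N)) (Ideal.mul_mem_left _ _ ?_))
    ?_) (sub_mem (Ideal.smul_mem_pow_of_mem_inertia hτ 2 hf) hf)
  · rw [sq]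
    exact Ideal.mul_mem_mul hN hπ
  · rw [sq]
    exact Ideal.mul_mem_mul (hτ _) (Ideal.smul_mem_of_mem_inertia hτ hπ)

/-- Tame elements of the inertia group have order dividing `#(B ⧸ P) - 1`. -/
theorem Ideal.pow_card_sub_one_eq_one_of_mem_inertia [IsDedekindDomain B] [FaithfulSMul G B]
    [P.IsMaximal] (hP : P ≠ ⊥) [Finite (B ⧸ P)] (hσ : σ ∈ P.toAddSubgroup.inertia G)
    {n : ℕ} (hn : (n : B) ∉ P) (h1 : σ ^ n = 1) : σ ^ (Nat.card (B ⧸ P) - 1) = 1 := by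
  refine FaithfulSMul.eq_of_smul_eq_smul (α := B) fun x ↦ ?_
  rw [one_smul]
  refine Ideal.smul_eq_of_pow_eq_one (pow_mem hσ _)
    (fun x hx ↦ Ideal.smul_pow_card_sub_one_sub_mem hP hσ hx) hn ?_ x
  rw [← pow_mul, mul_comm, pow_mul, h1, one_pow]

end Tame

/-! ### Cyclic groups and ramification in number fields -/

/-- In a cyclic group x^#I = 1 has at most #I solutions, so I contains all of them. For cyclic
p-groups this makes the subgroups a chain. -/
theorem IsCyclic.le_of_card_dvd {G : Type*} [Group G] [Finite G] [IsCyclic G] {H I : Subgroup G}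
    (h : Nat.card H ∣ Nat.card I) : H ≤ I := by
  classical
  have := Fintype.ofFinite G
  have key : ∀ (J : Subgroup G) (x : G), x ∈ J → x ^ Nat.card J = 1 := fun J x hx ↦
    congrArg Subtype.val (pow_card_eq_one' (x := (⟨x, hx⟩ : J)))
  set S : Finset G := {x | x ^ Nat.card I = 1}
  have h1 : (I : Set G).toFinset = S := by
    refine Finset.eq_of_subset_of_card_le (fun x hx ↦ ?_) ?_
    · have hx' : x ∈ I := by simpa using hx
      simpa [S] using key I x hx'
    · refine (IsCyclic.card_pow_eq_one_le Nat.card_pos).trans ?_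
      simp [Nat.card_eq_fintype_card]
  intro x hx
  have h2 : x ∈ S := by
    obtain ⟨c, hc⟩ := h
    simp only [S, Finset.mem_filter, Finset.mem_univ, true_and]
    rw [hc, pow_mul, key H x hx, one_pow]
  rw [← h1] at h2
  simpa using h2

open NumberField Ideal in
theorem NumberField.card_inertia_eq_ramificationIdx (K M G : Type*) [Field K] [NumberField K]
    [Field M] [NumberField M] [Algebra K M] [Group G] [Finite G] [MulSemiringAction G M]
    [IsGaloisGroup G K M] (Q : Ideal (𝓞 M)) [Q.IsMaximal] (hQ : Q ≠ ⊥) :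
    Nat.card (Q.toAddSubgroup.inertia G) = Q.ramificationIdx (𝓞 K) := by
  have hm : (Q.under (𝓞 K)).IsMaximal := Ideal.IsMaximal.under _ Q
  have hne : Q.under (𝓞 K) ≠ ⊥ := fun h ↦ hQ (Ideal.eq_bot_of_comap_eq_bot h)
  have : Finite (𝓞 K ⧸ Q.under (𝓞 K)) := Ring.HasFiniteQuotients.finiteQuotient hne
  rw [← ramificationIdxIn_eq_ramificationIdx (Q.under (𝓞 K)) Q G]
  exact card_inertia_eq_ramificationIdxIn (Q.under (𝓞 K)) Q

open NumberField Ideal in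
theorem NumberField.ramificationIdx_mul_inertiaDeg_le (K : Type*) [Field K] [NumberField K]
    (Q : Ideal (𝓞 K)) [Q.IsPrime] (hQ : Q ≠ ⊥) :
    Q.ramificationIdx ℤ * Q.inertiaDeg ℤ ≤ Module.finrank ℚ K := by
  rw [← RingOfIntegers.rank K]
  have hm : (Q.under ℤ).IsMaximal :=
    Ideal.IsPrime.isMaximal inferInstance fun h ↦ hQ (Ideal.eq_bot_of_comap_eq_bot h)
  have := (IsDedekindDomain.primesOver_finite (Q.under ℤ) (𝓞 K)).to_subtype
  have := Fintype.ofFinite ((Q.under ℤ).primesOver (𝓞 K))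
  rw [← sum_ramification_inertia_eq_finrank (Q.under ℤ) (𝓞 K)]
  exact Finset.single_le_sum (f := fun q : (Q.under ℤ).primesOver (𝓞 K) ↦
    q.1.ramificationIdx ℤ * q.1.inertiaDeg ℤ) (fun _ _ ↦ Nat.zero_le _)
    (Finset.mem_univ (⟨Q, ⟨inferInstance, inferInstance⟩⟩ : (Q.under ℤ).primesOver (𝓞 K)))

-- The prime q is totally ramified in ℚ(ζ), and ramification indices multiply in towers.
open NumberField Ideal in
theorem NumberField.sub_one_dvd_ramificationIdx (E : Type*) [Field E] [NumberField E] {q : ℕ}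
    [hq : Fact q.Prime] {ζ : E} (hζ : IsPrimitiveRoot ζ q) (Q : Ideal (𝓞 E)) [Q.IsPrime]
    [Q.LiesOver (span {(q : ℤ)})] : q - 1 ∣ Q.ramificationIdx ℤ := by
  have : NeZero q := ⟨hq.out.ne_zero⟩
  have hF : IsCyclotomicExtension {q} ℚ (IntermediateField.adjoin ℚ {ζ}) :=
    hζ.intermediateField_adjoin_isCyclotomicExtension ℚ
  set F := IntermediateField.adjoin ℚ {ζ}
  have : (Q.under (𝓞 F)).LiesOver (span {(q : ℤ)}) :=
    Ideal.LiesOver.tower_bot Q (Q.under (𝓞 F)) _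
  rw [← IsCyclotomicExtension.Rat.ramificationIdx_eq_of_prime q F (Q.under (𝓞 F))]
  exact ramificationIdx_below_dvd (Q.under (𝓞 F)) Q

theorem IsPrimitiveRoot.finrank_adjoin_le (K : Type*) {M : Type*} [Field K] [Field M] [Algebra K M]
    {n : ℕ} (hn : 0 < n) {ζ : M} (hζ : IsPrimitiveRoot ζ n) :
    Module.finrank K (IntermediateField.adjoin K {ζ}) ≤ n.totient := by
  have h : Polynomial.aeval ζ (Polynomial.cyclotomic n K) = 0 := by
    have := hζ.isRoot_cyclotomic hn
    rwa [Polynomial.IsRoot.def, ← Polynomial.map_cyclotomic n (algebraMap K M),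
      Polynomial.eval_map_algebraMap] at this
  rw [IntermediateField.adjoin.finrank
    ⟨_, Polynomial.cyclotomic.monic n K, by rwa [Polynomial.aeval_def] at h⟩,
    ← Polynomial.natDegree_cyclotomic n K]
  exact Polynomial.natDegree_le_of_dvd (minpoly.dvd K ζ h) (Polynomial.cyclotomic_ne_zero n K)

open NumberField Ideal in
theorem false_of_isCyclic_of_isPrimitiveRoot {K M : Type*} [Field K] [NumberField K] [Field M]
    [NumberField M] [Algebra K M] [IsGalois K M] [IsCyclic Gal(M/K)]
    (hK : Module.finrank ℚ K = 2) {p a m q : ℕ} (hp : p.Prime) (hp2 : 2 < p) (hm : 0 < m)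
    (hma : m < a) (hM : Module.finrank K M = p ^ a) (hq : q.Prime) (hqm : q = 2 * p ^ m + 1)
    {ζ : M} (hζ : IsPrimitiveRoot ζ q) : False := by
  have : Fact q.Prime := ⟨hq⟩
  have hq0 : span {(q : ℤ)} ≠ ⊥ := by simpa using hq.ne_zero
  have hqp : (span {(q : ℤ)}).IsPrime := by
    rw [Ideal.span_singleton_prime (by exact_mod_cast hq.ne_zero)]
    exact Nat.prime_iff_prime_int.1 hq
  obtain ⟨⟨Q, hQp, hQo⟩⟩ := (span {(q : ℤ)}).nonempty_primesOver (S := 𝓞 M)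
  have hQ0 : Q ≠ ⊥ := Ideal.ne_bot_of_liesOver_of_ne_bot hq0 Q
  have hQm : Q.IsMaximal := hQp.isMaximal hQ0
  set E := IntermediateField.adjoin K {ζ}
  set G := Gal(M/K)
  set H := fixingSubgroup G (E : Set M)
  set I := Q.toAddSubgroup.inertia G
  have hG : Nat.card G = p ^ a := by rw [← hM, IsGaloisGroup.card_eq_finrank G K M]
  have : NumberField E := NumberField.of_intermediateField ..
  have hQK : (Q.under (𝓞 K)).IsMaximal := Ideal.IsMaximal.under _ Q
  have hQE : (Q.under (𝓞 E)).IsMaximal := Ideal.IsMaximal.under _ Q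
  have : (Q.under (𝓞 E)).LiesOver (span {(q : ℤ)}) := Ideal.LiesOver.tower_bot Q _ _
  have hI : Nat.card I = Q.ramificationIdx (𝓞 K) :=
    NumberField.card_inertia_eq_ramificationIdx K M G Q hQ0
  have hHI : Nat.card (Q.toAddSubgroup.inertia H) = Q.ramificationIdx (𝓞 E) :=
    NumberField.card_inertia_eq_ramificationIdx E M H Q hQ0
  have hcHI : Nat.card (Q.toAddSubgroup.inertia H) = Nat.card (I ⊓ H : Subgroup G) := by
    rw [← AddSubgroup.inertia_map_subtype]
    exact (Subgroup.card_map_of_injective H.subtype_injective).symm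
  have e1 : Q.ramificationIdx ℤ = (Q.under (𝓞 K)).ramificationIdx ℤ * Nat.card I := by
    rw [hI]
    exact ramificationIdx_tower _ Q
  have e2 : Q.ramificationIdx ℤ = (Q.under (𝓞 E)).ramificationIdx ℤ *
      Nat.card (I ⊓ H : Subgroup G) := by
    rw [← hcHI, hHI]
    exact ramificationIdx_tower _ Q
  have he : (Q.under (𝓞 K)).ramificationIdx ℤ ≤ 2 := by
    rw [← hK]
    exact (Nat.le_mul_of_pos_right _ (inertiaDeg_pos _ _)).trans
      (NumberField.ramificationIdx_mul_inertiaDeg_le K _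
        fun h ↦ hQ0 (Ideal.eq_bot_of_comap_eq_bot h))
  have hζE : IsPrimitiveRoot (IntermediateField.AdjoinSimple.gen K ζ) q :=
    IsPrimitiveRoot.of_map_of_injective (f := algebraMap E M) hζ (algebraMap E M).injective
  obtain ⟨c, hc⟩ := NumberField.sub_one_dvd_ramificationIdx E hζE (Q.under (𝓞 E))
  rw [hqm, Nat.add_sub_cancel] at hc
  have hc0 : 0 < c := by
    have := ramificationIdx_pos (Q.under (𝓞 E)) ℤ
    rw [hc] at this
    exact Nat.pos_of_mul_pos_left this
  have hHcard : p ^ a ≤ Nat.card H * p ^ m := by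
    have h1 : Nat.card H * Module.finrank K E = p ^ a := by
      rw [mul_comm, ← hM, ← Module.finrank_mul_finrank K E M,
        IsGaloisGroup.card_eq_finrank H E M]
    have h2 : Module.finrank K E ≤ 2 * p ^ m := by
      have := hζ.finrank_adjoin_le K hq.pos
      rwa [Nat.totient_prime hq, hqm, Nat.add_sub_cancel] at this
    -- [E:K] is a power of p and at most 2p^m < p^(m+1), hence at most p^m.
    obtain ⟨j, -, hj⟩ := (Nat.dvd_prime_pow hp).1 (Dvd.intro_left _ h1)
    have h3 : j ≤ m := by
      by_contra! h
      have h4 : p ^ (m + 1) ≤ p ^ j := Nat.pow_le_pow_right hp.pos h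
      rw [pow_succ] at h4
      have h5 := pow_pos hp.pos m
      nlinarith
    rw [← h1, hj]
    gcongr
    exact hp.one_le
  have hle : p ≤ p ^ m := Nat.le_self_pow hm.ne' p
  have heM : 2 * p ^ a ≤ Q.ramificationIdx ℤ := by
    obtain ⟨i, -, hi⟩ := (Nat.dvd_prime_pow hp).1 (hG ▸ Subgroup.card_subgroup_dvd_card I)
    obtain ⟨h, -, hh⟩ := (Nat.dvd_prime_pow hp).1 (hG ▸ Subgroup.card_subgroup_dvd_card H)
    rw [hc] at e2
    -- If I ≤ H, then M/E absorbs all the inertia and 2p^m would divide the ramification index of K,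
    -- which is at most 2. So H ≤ I.
    rcases le_total i h with hih | hih
    · rw [inf_eq_left.2 (IsCyclic.le_of_card_dvd (hi ▸ hh ▸ pow_dvd_pow p hih)), e1] at e2
      have h1 := Nat.eq_of_mul_eq_mul_right Nat.card_pos e2
      have h2 : 2 * p ^ m ≤ 2 * p ^ m * c := Nat.le_mul_of_pos_right _ hc0
      omega
    · rw [inf_eq_right.2 (IsCyclic.le_of_card_dvd (hi ▸ hh ▸ pow_dvd_pow p hih))] at e2
      calc 2 * p ^ a ≤ 2 * (Nat.card H * p ^ m) := Nat.mul_le_mul_left 2 hHcard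
        _ ≤ 2 * (Nat.card H * p ^ m) * c := Nat.le_mul_of_pos_right _ hc0
        _ = Q.ramificationIdx ℤ := by rw [e2]; ring
  have hIG : p ^ a ≤ Nat.card I := by
    rw [e1] at heM
    have := heM.trans (Nat.mul_le_mul_right _ he)
    omega
  have hdegM : Module.finrank ℚ M = 2 * p ^ a := by
    rw [← Module.finrank_mul_finrank ℚ K M, hK, hM]
  -- The ramification index alone already exhausts the degree [M:ℚ] = 2p^a.
  have hf : Q.inertiaDeg ℤ = 1 := by
    have h1 := NumberField.ramificationIdx_mul_inertiaDeg_le M Q hQ0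
    have h2 := inertiaDeg_pos Q ℤ
    have h3 : 0 < 2 * p ^ a := Nat.mul_pos two_pos (pow_pos hp.pos a)
    rw [hdegM] at h1
    have h4 : 2 * p ^ a * Q.inertiaDeg ℤ ≤ 2 * p ^ a * 1 := by
      rw [mul_one]
      exact (Nat.mul_le_mul_right _ heM).trans h1
    have := Nat.le_of_mul_le_mul_left h4 h3
    omega
  have hcard : Nat.card (𝓞 M ⧸ Q) = q := by
    have := pow_inertiaDeg q Q
    rw [hf, pow_one] at this
    rw [this, Ideal.absNorm_apply]; rfl
  have : Finite (𝓞 M ⧸ Q) := Nat.finite_of_card_ne_zero (hcard ▸ hq.ne_zero)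
  obtain ⟨σ, hσ⟩ := IsCyclic.exists_ofOrder_eq_natCard (α := G)
  have hσI : σ ∈ I := by
    have : I = ⊤ := Subgroup.eq_top_of_le_card I (hG ▸ hIG)
    rw [this]
    exact Subgroup.mem_top σ
  have hn : ((p ^ a : ℕ) : 𝓞 M) ∉ Q := by
    have hqQ : (q : 𝓞 M) ∈ Q := by
      have := (Ideal.mem_of_liesOver Q (span {(q : ℤ)}) (q : ℤ)).1 (mem_span_singleton_self _)
      simpa using this
    intro hpQ
    have hcop : IsCoprime ((p ^ a : ℕ) : ℤ) (q : ℤ) := by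
      rw [Nat.isCoprime_iff_coprime]
      refine Nat.Coprime.pow_left a ((Nat.coprime_primes hp hq).2 ?_)
      omega
    obtain ⟨u, v, huv⟩ := hcop
    refine hQp.ne_top ((Ideal.eq_top_iff_one Q).2 ?_)
    have h1 : (u : 𝓞 M) * (p ^ a : ℕ) + v * q = 1 := by
      exact_mod_cast congrArg (Int.cast : ℤ → 𝓞 M) huv
    rw [← h1]
    exact add_mem (Ideal.mul_mem_left _ _ hpQ) (Ideal.mul_mem_left _ _ hqQ)
  have : FaithfulSMul G (𝓞 M) := (inferInstance : IsGaloisGroup G (𝓞 K) (𝓞 M)).faithful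
  have := Ideal.pow_card_sub_one_eq_one_of_mem_inertia hQ0 hσI hn
    (by rw [← hG]; exact pow_card_eq_one')
  have := orderOf_dvd_of_pow_eq_one this
  rw [hσ, hG, hcard, hqm, Nat.add_sub_cancel] at this
  have h1 : p ^ (m + 1) ∣ 2 * p ^ m := (pow_dvd_pow p hma).trans this
  rw [pow_succ', Nat.mul_dvd_mul_iff_right (pow_pos hp.pos m)] at h1
  exact absurd (Nat.le_of_dvd two_pos h1) (by omega)

/-! ### Arithmetic of the possible orders -/

theorem Nat.Prime.eq_two_mul_pow_add_one_of_totient_dvd {p r k m : ℕ} (hp : p.Prime) (hp3 : 3 < p)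
    (hr : r.Prime) (hm : 0 < m) (hdvd : (r ^ k).totient ∣ 2 * p ^ m)
    (hle : p ^ m ≤ (r ^ k).totient) : k = 1 ∧ r = 2 * p ^ m + 1 := by
  have hpm : p ≤ p ^ m := Nat.le_self_pow hm.ne' p
  have hodd : Odd (p ^ m) := (hp.odd_of_ne_two (by omega)).pow
  obtain _ | _ | k := k
  · simp at hle
    omega
  · rw [zero_add, pow_one, Nat.totient_prime hr] at hdvd hle
    refine ⟨rfl, ?_⟩
    have hr2 := hr.two_le
    obtain ⟨c, hc⟩ := hdvd
    have hc2 : c ≤ 2 := by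
      by_contra! h
      have := Nat.mul_le_mul hle h
      omega
    -- Here 2p^m = (r - 1)c. The case c = 2 would give r = p^m + 1, an even number above 2.
    interval_cases c
    · omega
    · omega
    · obtain ⟨t, ht⟩ := hodd
      obtain h | h := hr.eq_two_or_odd'
      · omega
      · obtain ⟨s, hs⟩ := h
        omega
  · rw [Nat.totient_prime_pow_succ hr] at hdvd hle
    exfalso
    have h1 : r ∣ 2 * p ^ m :=
      (dvd_pow_self r (Nat.succ_ne_zero k)).trans ((Dvd.intro _ rfl).trans hdvd)
    obtain h2 | h2 := (Nat.Prime.dvd_mul hr).1 h1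
    · have hr2 : r = 2 := (Nat.prime_dvd_prime_iff_eq hr Nat.prime_two).1 h2
      subst hr2
      rw [show 2 - 1 = 1 from rfl, mul_one] at hdvd hle
      have h3 : Nat.Coprime (2 ^ (k + 1)) (p ^ m) :=
        Nat.Coprime.pow _ _ ((Nat.coprime_primes hr hp).2 (by omega))
      have := Nat.le_of_dvd two_pos (h3.dvd_of_dvd_mul_right hdvd)
      omega
    · have hrp : r = p := (Nat.prime_dvd_prime_iff_eq hr hp).1 (hr.dvd_of_dvd_pow h2)
      subst hrp
      -- With r = p, p - 1 is prime to p^m and so divides 2. This fails only for p > 3: ninth roots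
      -- of unity over ℚ(ζ₃) are the exception at p = 3.
      have h3 : r - 1 ∣ 2 * r ^ m := (Dvd.intro_left _ rfl).trans hdvd
      have h4 : Nat.Coprime (r - 1) (r ^ m) := by
        refine Nat.Coprime.pow_right m ?_
        have := Nat.coprime_self_add_right (m := r - 1) (n := 1)
        rw [Nat.sub_add_cancel hr.one_le] at this
        exact this.2 (Nat.coprime_one_right _)
      have := Nat.le_of_dvd two_pos (h4.dvd_of_dvd_mul_right h3)
      omega

theorem IsPrimitiveRoot.totient_dvd_finrank {E : Type*} [Field E] [NumberField E] {n : ℕ}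
    [NeZero n] {ζ : E} (hζ : IsPrimitiveRoot ζ n) : n.totient ∣ Module.finrank ℚ E := by
  have : IsCyclotomicExtension {n} ℚ (IntermediateField.adjoin ℚ {ζ}) :=
    hζ.intermediateField_adjoin_isCyclotomicExtension ℚ
  rw [← IsCyclotomicExtension.Rat.finrank n (IntermediateField.adjoin ℚ {ζ}),
    ← Module.finrank_mul_finrank ℚ (IntermediateField.adjoin ℚ {ζ}) E]
  exact Dvd.intro _ rfl

theorem IsPrimitiveRoot.exists_eq_two_mul_pow_add_one {K M : Type*} [Field K] [NumberField K]
    [Field M] [NumberField M] [Algebra K M] (hK : Module.finrank ℚ K = 2) {p a r k : ℕ}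
    (hp : p.Prime) (hp3 : 3 < p) (hM : Module.finrank K M = p ^ a) (hr : r.Prime) {ζ : M}
    (hζ : IsPrimitiveRoot ζ (r ^ k)) (hζK : ζ ∉ (algebraMap K M).range) :
    ∃ m, 0 < m ∧ k = 1 ∧ r = 2 * p ^ m + 1 := by
  set E := IntermediateField.adjoin K {ζ}
  have : NumberField E := NumberField.of_intermediateField ..
  have : NeZero (r ^ k) := ⟨(pow_pos hr.pos k).ne'⟩
  have hζE : IsPrimitiveRoot (IntermediateField.AdjoinSimple.gen K ζ) (r ^ k) :=
    IsPrimitiveRoot.of_map_of_injective (f := algebraMap E M) hζ (algebraMap E M).injective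
  obtain ⟨m, -, hm⟩ := (Nat.dvd_prime_pow hp).1
    (Dvd.intro _ ((Module.finrank_mul_finrank K E M).trans hM))
  have hm0 : 0 < m := Nat.pos_of_ne_zero fun h ↦ by
    rw [h, pow_zero, IntermediateField.finrank_adjoin_simple_eq_one_iff] at hm
    exact hζK (IntermediateField.mem_bot.1 hm)
  refine ⟨m, hm0, hp.eq_two_mul_pow_add_one_of_totient_dvd hp3 hr hm0 ?_ ?_⟩
  · rw [← hm, ← hK, Module.finrank_mul_finrank ℚ K E]
    exact hζE.totient_dvd_finrank
  · rw [← hm]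
    exact hζ.finrank_adjoin_le K (pow_pos hr.pos k)

/-! ### Finite layers of a ℤ_p-extension -/

theorem PadicInt.exists_ker_toZModPow_subset {p : ℕ} [hp : Fact p.Prime]
    {U : Set ℤ_[p]} (hU : U ∈ nhds 0) :
    ∃ N, ∀ a ≥ N, ∀ x : ℤ_[p], PadicInt.toZModPow a x = 0 → x ∈ U := by
  obtain ⟨ε, hε, hεU⟩ := Metric.mem_nhds_iff.1 hU
  obtain ⟨N, hN⟩ := PadicInt.exists_pow_neg_lt p hε
  refine ⟨N, fun a ha x hx ↦ hεU ?_⟩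
  rw [← RingHom.mem_ker, PadicInt.ker_toZModPow, ← PadicInt.norm_le_pow_iff_mem_span_pow] at hx
  rw [mem_ball_zero_iff]
  refine (hx.trans ?_).trans_lt hN
  exact zpow_le_zpow_right₀ (by exact_mod_cast hp.out.one_le) (by omega)

namespace IsZpExtension

variable {p : ℕ} [hp : Fact p.Prime] {K L : Type*} [Field K] [Field L] [Algebra K L]

/-- Every element of a `ℤ_p`-extension lies in all the sufficiently high finite layers. -/
theorem exists_layer (h : IsZpExtension p K L) (x : L) :
    ∃ N, ∀ a ≥ N, ∃ M : IntermediateField K L, x ∈ M ∧ IsGalois K M ∧ IsCyclic Gal(M/K) ∧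
      FiniteDimensional K M ∧ Module.finrank K M = p ^ a := by
  have := h.isGalois
  obtain ⟨e⟩ := h.nonempty_continuousMulEquiv
  have hfin : FiniteDimensional K (IntermediateField.adjoin K {x}) :=
    IntermediateField.adjoin.finiteDimensional (Algebra.IsIntegral.isIntegral x)
  have hopen := (InfiniteGalois.isOpen_iff_finite (IntermediateField.adjoin K {x})).2 hfin
  have hU : (fun z : ℤ_[p] ↦ e.symm (Multiplicative.ofAdd z)) ⁻¹'
      (IntermediateField.adjoin K {x}).fixingSubgroup ∈ nhds 0 := by
    refine (hopen.preimage (e.symm.continuous.comp continuous_ofAdd)).mem_nhds ?_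
    have h1 : e.symm (Multiplicative.ofAdd 0) = 1 := by rw [ofAdd_zero, map_one]
    exact (congrArg (· ∈ (IntermediateField.adjoin K {x}).fixingSubgroup) h1).mpr (one_mem _)
  obtain ⟨N, hN⟩ := PadicInt.exists_ker_toZModPow_subset hU
  refine ⟨N, fun a ha ↦ ?_⟩
  -- The layer is the fixed field of the kernel of reduction modulo p^a; for a ≥ N this kernel fixes
  -- x.
  let φ : Gal(L/K) →* Multiplicative (ZMod (p ^ a)) :=
    (AddMonoidHom.toMultiplicative (PadicInt.toZModPow a).toAddMonoidHom).comp
      (e : Gal(L/K) →* Multiplicative ℤ_[p])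
  have hφs : Function.Surjective φ := fun y ↦ by
    obtain ⟨z, hz⟩ := ZMod.ringHom_surjective (PadicInt.toZModPow (p := p) a) y.toAdd
    refine ⟨e.symm (Multiplicative.ofAdd z), ?_⟩
    simp [φ, hz]
  have hφo : IsOpen (φ.ker : Set Gal(L/K)) := by
    have h1 : (φ.ker : Set Gal(L/K)) =
        (fun σ ↦ (e σ).toAdd) ⁻¹' Metric.closedBall 0 ((p : ℝ) ^ (-a : ℤ)) := by
      ext σ
      rw [Set.mem_preimage, mem_closedBall_zero_iff, PadicInt.norm_le_pow_iff_mem_span_pow,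
        ← PadicInt.ker_toZModPow, RingHom.mem_ker]
      rfl
    rw [h1]
    refine (IsUltrametricDist.isOpen_closedBall _ ?_).preimage
      (continuous_toAdd.comp e.continuous)
    exact (zpow_pos (by exact_mod_cast hp.out.pos) _).ne'
  let V : ClosedSubgroup Gal(L/K) := ⟨φ.ker, Subgroup.isClosed_of_isOpen _ hφo⟩
  have hVn : V.1.Normal := φ.normal_ker
  let M := IntermediateField.fixedField V.1
  have hMV : M.fixingSubgroup = V.1 := InfiniteGalois.fixingSubgroup_fixedField V
  have : NeZero (p ^ a) := ⟨(pow_pos hp.out.pos a).ne'⟩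
  let f : Gal(M/K) ≃* Multiplicative (ZMod (p ^ a)) :=
    (InfiniteGalois.normalAutEquivQuotient V).symm.trans
      (QuotientGroup.quotientKerEquivOfSurjective φ hφs)
  have hG : IsGalois K M := (InfiniteGalois.normal_iff_isGalois M).1 (hMV ▸ hVn)
  have hC : IsCyclic Gal(M/K) := isCyclic_of_injective f.toMonoidHom f.injective
  have hMfin : FiniteDimensional K M := by
    rw [← InfiniteGalois.isOpen_iff_finite, hMV]
    exact hφo
  refine ⟨M, ?_, hG, hC, hMfin, ?_⟩
  · rintro ⟨σ, hσ⟩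
    have h1 := hN a ha (e σ).toAdd (congrArg Multiplicative.toAdd hσ)
    rw [Set.mem_preimage, ofAdd_toAdd, ContinuousMulEquiv.symm_apply_apply] at h1
    exact h1 ⟨x, IntermediateField.mem_adjoin_simple_self K x⟩
  · rw [← IsGalois.card_aut_eq_finrank, Nat.card_congr f.toEquiv]
    simp

end IsZpExtension

/-! ### Conclusion -/

theorem IsZpExtension.mem_range_of_isPrimitiveRoot_prime_pow {K L : Type*} [Field K] [NumberField K]
    [Field L] [Algebra K L] (hK : Module.finrank ℚ K = 2) {p : ℕ} [hp : Fact p.Prime] (hp3 : 3 < p)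
    (hL : IsZpExtension p K L) {r k : ℕ} (hr : r.Prime) {ζ : L} (hζ : IsPrimitiveRoot ζ (r ^ k)) :
    ζ ∈ (algebraMap K L).range := by
  by_contra hζK
  obtain ⟨N, hN⟩ := hL.exists_layer ζ
  -- Taking a ≥ r ensures m < a before m is known: once r = 2p^m + 1, m < p^m < r ≤ a.
  obtain ⟨M, hζM, hG, hC, hfin, hdeg⟩ := hN (max N r) (le_max_left _ _)
  have : CharZero M := charZero_of_injective_algebraMap (algebraMap K M).injective
  have : FiniteDimensional ℚ M := FiniteDimensional.trans ℚ K M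
  have : NumberField M := {}
  have hζ' : IsPrimitiveRoot (⟨ζ, hζM⟩ : M) (r ^ k) :=
    IsPrimitiveRoot.of_map_of_injective (f := algebraMap M L) hζ (algebraMap M L).injective
  obtain ⟨m, hm, rfl, hrm⟩ := hζ'.exists_eq_two_mul_pow_add_one hK hp.out hp3 hdeg hr (by
    rintro ⟨y, hy⟩
    exact hζK ⟨y, congrArg Subtype.val hy⟩)
  rw [pow_one] at hζ'
  refine false_of_isCyclic_of_isPrimitiveRoot hK hp.out (by omega) hm ?_ hdeg hr hrm hζ'
  have h1 : m < p ^ m := Nat.lt_pow_self hp.out.one_lt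
  have h2 : r ≤ max N r := le_max_right _ _
  omega

theorem lemma3p6 {Ω : Type*} [Field Ω] [CharZero Ω] [IsAlgClosed Ω]
    (K : IntermediateField ℚ Ω) (hK : Module.finrank ℚ K = 2)
    (p : ℕ) [Fact p.Prime] (hp : 3 < p)
    (L : IntermediateField K Ω) (hL : IsZpExtension p K L)
    (n : ℕ) (hn : 0 < n) (hμ : muSet n Ω ⊆ (L : Set Ω)) :
    muSet n Ω ⊆ (K : Set Ω) := by
  have : FiniteDimensional ℚ K := Module.finite_of_finrank_pos (by omega)
  have : NumberField K := {}
  induction n using Nat.recOnPosPrimePosCoprime with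
  | zero => omega
  | one =>
    intro ζ hζ
    have : ζ = 1 := by simpa [muSet] using hζ
    rw [this]
    exact one_mem K
  | prime_pow r k hr hk =>
    intro ζ hζ
    have hζ1 : ζ ^ r ^ k = 1 := hζ
    obtain ⟨j, -, hj⟩ := (Nat.dvd_prime_pow hr).1 (orderOf_dvd_of_pow_eq_one hζ1)
    have hζ' : IsPrimitiveRoot (⟨ζ, hμ hζ⟩ : L) (r ^ j) :=
      IsPrimitiveRoot.of_map_of_injective (f := algebraMap L Ω) (hj ▸ IsPrimitiveRoot.orderOf ζ)
        (algebraMap L Ω).injective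
    obtain ⟨y, hy⟩ := hL.mem_range_of_isPrimitiveRoot_prime_pow hK hp hr hζ'
    have : (y : Ω) = ζ := congrArg Subtype.val hy
    exact this ▸ y.2
  | coprime a b ha hb hab iha ihb =>
    have hsub : ∀ {c d : ℕ}, c ∣ d → muSet c Ω ⊆ muSet d Ω := by
      rintro c _ ⟨d, rfl⟩ ζ hζ
      have hζ1 : ζ ^ c = 1 := hζ
      show ζ ^ (c * d) = 1
      rw [pow_mul, hζ1, one_pow]
    have hKa := iha (by omega) ((hsub (Dvd.intro _ rfl)).trans hμ)
    have hKb := ihb (by omega) ((hsub (Dvd.intro_left _ rfl)).trans hμ)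
    intro ζ hζ
    have hζ1 : ζ ^ (a * b) = 1 := hζ
    have ha' : ζ ^ a ∈ K := hKb (show (ζ ^ a) ^ b = 1 by rw [← pow_mul, hζ1])
    have hb' : ζ ^ b ∈ K := hKa (show (ζ ^ b) ^ a = 1 by rw [← pow_mul, mul_comm, hζ1])
    obtain ⟨u, v, huv⟩ := Nat.isCoprime_iff_coprime.2 hab
    have hζ0 : ζ ≠ 0 := by
      rintro rfl
      rw [zero_pow (by positivity)] at hζ1
      exact zero_ne_one hζ1
    -- Bézout: ua + vb = 1, and both powers lie in K by induction.
    have e : ζ = (ζ ^ a) ^ u * (ζ ^ b) ^ v := by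
      rw [← zpow_natCast, ← zpow_natCast, ← zpow_mul, ← zpow_mul, ← zpow_add₀ hζ0, mul_comm,
        mul_comm (b : ℤ), huv, zpow_one]
    have := mul_mem (zpow_mem ha' u) (zpow_mem hb' v)
    rwa [← e] at this
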